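/- **Notation.** For a set $Z$ and a map $f:Z\to\mathbb R^n$ let $\mathcal V_f\subset\mathbb R^{n\times n}$ be the span of the matrices $f(z)f(z)^\top$, $z\in Z$, let $\mathcal V_f^\perp$ be its orthogonal complement for the trace inner product, $\mathcal K_f$ the closure of the convex hull of these matrices, and $\widehat{\mathcal K}_f=\{S\in\mathcal V_f:\ S\succcurlyeq0,\ \operatorname{tr}S=1\}$. Write $\mathbb S_n$ for the symmetric $n\times n$ matrices. A matrix $T\in\mathbb R^{np\times np}$ is viewed as $p\times p$ blocks $T_{ij}\in\mathbb R^{n\times n}$; $T[uu^\top]\in\mathbb R^{p\times p}$ has entries $u^\top T_{ij}u$, and $\widetilde{\operatorname{tr}}[T]=\sum_iT_{ii}\in\mathbb R^{n\times n}$. $\|\cdot\|_{\rm F}$ is the Frobenius norm. **Setting.** Let $\mathcal X\subset\mathbb R^d$ and $\mathcal Y\subset\mathbb R^e$ be nonempty compact sets, and let $\varphi:\mathcal X\to\mathbb R^m$, $\psi:\mathcal Y\to\mathbb R^p$ be feature maps with polynomial coordinates and unit Euclidean norm, $\|\varphi(x)\|=\|\psi(y)\|=1$ for $x\in\mathcal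 X$, $y\in\mathcal Y$. Let $G\in\mathbb R^{mp\times mp}$ be symmetric and $$g(x,y)=\operatorname{tr}\big[G\,(\psi(y)\psi(y)^\top\otimes\varphi(x)\varphi(x)^\top)\big],\qquad (x,y)\in\mathcal X\times\mathcal Y .$$ **The relaxation.** For a unit-norm feature map $f:\mathcal X\to\mathbb R^n$ and a symmetric $G'\in\mathbb R^{np\times np}$ with $g(x,y)=\operatorname{tr}[G'(\psi(y)\psi(y)^\top\otimes f(x)f(x)^\top)]$ on $\mathcal X\times\mathcal Y$, the primal–dual SOS relaxation of $\min_{x}\max_{y}g(x,y)$ is $$\min_{\Sigma}\ \max_{T}\ \operatorname{tr}\Big(\Sigma\sum_{i,j=1}^pG'_{ij}\otimes T_{ij}\Big),$$ over $\Sigma\in\mathbb R^{n^2\times n^2}$ with $\Sigma\succcurlyeq0$, $\Sigma\in\mathcal V_{f\otimes f}$, $\operatorname{tr}\Sigma=1$, where $(f\otimes f)(x)=f(x)\otimes f(x)$, and over $T\in\mathbb R^{np\times np}$ with $T\succcurlyeq0$, $T\in\mathbb S_p\otimes\mathcal V_f^\perp+\mathcal V_\psi\otimes\mathbb S_n$ and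 $\widetilde{\operatorname{tr}}[T]-I\in\mathcal V_f^\perp$ (in the products the first factor indexes the blocks). **Enlarged features.** Additional feature maps $\varphi_1^+:\mathcal X\to\mathbb R^{m_1}$, $\varphi_2^+:\mathcal X\to\mathbb R^{m_2}$ have polynomial coordinates and constant Euclidean norm on $\mathcal X$. Put $\varphi_1=(\varphi,\varphi_1^+)$ and $\tilde\varphi=(\varphi,\varphi_1^+,\varphi_2^+)$, so that $\kappa:=\|\tilde\varphi(x)\|^2$ does not depend on $x\in\mathcal X$. The relaxation with $\varphi$ replaced by $\tilde\varphi$ is the one above for the unit-norm map $f=\kappa^{-1/2}\tilde\varphi$ and the matrix $G'$ with blocks $\kappa\begin{pmatrix}G_{ij}&0\\0&0\end{pmatrix}$, which represents the same function $g$. **Assumptions.** * **(A1)** $\widehat{\mathcal K}_\psi=\mathcal K_\psi$. * **(A2)** For every $\delta>0$ there is $\varphi_1^+$ with the following property: for every Lipschitz function $u:\mathcal X\to\mathbb R$ there is a matrix $H$ with $|u(x)-\varphi_1(x)^\top H\varphi_1(x)|\le\operatorname{Lip}(u)\,\delta$ for all $x\in\mathcal X$. (That is, the approximation constant $\varepsilon^{\rm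 app}(\varphi,\varphi_1^+)$ can be made arbitrarily small.) * **(A3)** For every $\varphi_1^+$ and every $\delta>0$ there is $\varphi_2^+$ such that $\delta$ is an SOS approximability ratio, that is (the ratio $\varepsilon^{\rm SOS}(\varphi,\varphi_1^+,\varphi_2^+)$ can be made arbitrarily small): (i) for every $s$ and every symmetric $H\in\mathbb R^{(m+m_1)s\times(m+m_1)s}$, if $H[\varphi_1(x)\varphi_1(x)^\top]\succcurlyeq\delta\|H\|_{\rm F}I$ for all $x\in\mathcal X$, then there is $A\succcurlyeq0$ with $H[\varphi_1(x)\varphi_1(x)^\top]=A[\tilde\varphi(x)\tilde\varphi(x)^\top]$ for all $x\in\mathcal X$; (ii) for every symmetric $H\in\mathbb R^{(m+m_1)^2\times(m+m_1)^2}$, if $(\varphi_1(x)\otimes\varphi_1(x))^\top H(\varphi_1(x)\otimes\varphi_1(x))\ge\delta\|H\|_{\rm F}$ for all $x\in\mathcal X$, then there is $A\succcurlyeq0$ such that this function equals $(\tilde\varphi(x)\otimes\tilde\varphi(x))^\top A(\tilde\varphi(x)\otimes\tilde\varphi(x))$ for all $x\in\mathcal X$. **Theorem.** Assume (A1), (A2)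 and (A3). Then for every $\varepsilon>0$ there exist feature maps $\varphi_1^+$ and $\varphi_2^+$ such that the optimal value of the primal–dual SOS relaxation with $\varphi$ replaced by $\tilde\varphi=(\varphi,\varphi_1^+,\varphi_2^+)$ is finite and differs from $\min_{x\in\mathcal X}\max_{y\in\mathcal Y}g(x,y)$ by at most $\varepsilon$. -/

import Mathlib

open scoped NNReal Matrix

noncomputable section

namespace MinMaxSOS

/-! ### Feature maps and moment matrices -/

/-- The vector `(P_i(x))_i` of values at `x ∈ ℝ^d` of a family `P` of polynomials in `d` variables
(a polynomial feature map). -/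
def feat {d : ℕ} {ι : Type} (P : ι → MvPolynomial (Fin d) ℝ) (x : EuclideanSpace ℝ (Fin d)) :
    ι → ℝ :=
  fun i => MvPolynomial.eval (fun k => x k) (P i)

/-- The feature map `P` has constant squared Euclidean norm `c` on `X`. -/
def HasSqNorm {d : ℕ} {ι : Type} [Fintype ι] (X : Set (EuclideanSpace ℝ (Fin d)))
    (P : ι → MvPolynomial (Fin d) ℝ) (c : ℝ) : Prop :=
  ∀ x ∈ X, ∑ i, feat P x i ^ 2 = c

/-- The rank-one matrix `u uᵀ`. -/
def outer {ι : Type} (u : ι → ℝ) : Matrix ι ι ℝ := Matrix.vecMulVec u u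

/-- The tensor square `u ⊗ u` of a vector. Note that `outer (u ⊗ u) = u uᵀ ⊗ u uᵀ`. -/
def tensorSq {ι : Type} (u : ι → ℝ) : ι × ι → ℝ := fun a => u a.1 * u a.2

/-- `𝒱_f`: the span of all `f(x) f(x)ᵀ`, `x ∈ X`. -/
def momentSpan {α ι : Type} (X : Set α) (f : α → ι → ℝ) : Submodule ℝ (Matrix ι ι ℝ) :=
  Submodule.span ℝ ((fun x => outer (f x)) '' X)

/-- `𝒱^⊥`: the matrices orthogonal to `V` for the inner product `tr (Mᵀ N)`. -/
def orthComplement {ι : Type} [Fintype ι] (V : Submodule ℝ (Matrix ι ι ℝ)) :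
    Set (Matrix ι ι ℝ) :=
  {M | ∀ N ∈ V, (Mᵀ * N).trace = 0}

/-- `𝒦_f`: the closure of the convex hull of all `f(x) f(x)ᵀ`, `x ∈ X`. -/
def momentHull {α ι : Type} (X : Set α) (f : α → ι → ℝ) : Set (Matrix ι ι ℝ) :=
  closure (convexHull ℝ ((fun x => outer (f x)) '' X))

/-- `𝒦̂_f`: the pseudo-moment matrices `S ∈ 𝒱_f`, `S ≽ 0`, `tr S = 1`. -/
def pseudoMoments {α ι : Type} [Fintype ι] (X : Set α) (f : α → ι → ℝ) :
    Set (Matrix ι ι ℝ) :=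
  {S | S ∈ momentSpan X f ∧ S.PosSemidef ∧ S.trace = 1}

/-! ### Block matrices

A matrix of size `mp × mp` made of `p × p` blocks of size `m × m` is indexed by pairs
`(i, a)`, where `i` selects the block and `a` the position in the block. -/

/-- The block `T_{ij}`. -/
def block {π ι : Type} (T : Matrix (π × ι) (π × ι) ℝ) (i j : π) : Matrix ι ι ℝ :=
  Matrix.of fun a b => T (i, a) (j, b)

/-- `T[u uᵀ]`, the matrix with entries `uᵀ T_{ij} u`. -/
def blockForm {π ι : Type} [Fintype ι] (T : Matrix (π × ι) (π × ι) ℝ) (u : ι → ℝ) :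
    Matrix π π ℝ :=
  Matrix.of fun i j => u ⬝ᵥ (block T i j *ᵥ u)

/-- The partial trace: the sum of the diagonal blocks, with entries
`∑_i T_{(i,a),(i,b)}`. -/
def partialTrace {π ι : Type} [Fintype π] (T : Matrix (π × ι) (π × ι) ℝ) : Matrix ι ι ℝ :=
  ∑ i, block T i i

/-- The span of the Kronecker products `N ⊗ M` with `N ∈ A` (indexing blocks) and `M ∈ B`
(inside blocks). -/
def tensorSpan {π ι : Type} (A : Set (Matrix π π ℝ)) (B : Set (Matrix ι ι ℝ)) :
    Submodule ℝ (Matrix (π × ι) (π × ι) ℝ) :=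
  Submodule.span ℝ {K | ∃ N ∈ A, ∃ M ∈ B, K = Matrix.kronecker N M}

/-- The set `𝕊` of symmetric matrices. -/
def symMatrices (ι : Type) : Set (Matrix ι ι ℝ) := {M | M.IsSymm}

/-- The Frobenius norm. -/
def frobNorm {ι : Type} [Fintype ι] (H : Matrix ι ι ℝ) : ℝ :=
  Real.sqrt (∑ a, ∑ b, H a b ^ 2)

/-! ### The min-max problem and its primal-dual SOS relaxation -/

/-- The value of `min_{x ∈ X} max_{y ∈ Y} g(x,y)`, as an extended real. -/
def minMaxValue {α β : Type} (X : Set α) (Y : Set β) (g : α → β → ℝ) : EReal :=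
  ⨅ x ∈ X, ⨆ y ∈ Y, (g x y : EReal)

/-- The feasible matrices `T` of the relaxation: `T ≽ 0`,
`T ∈ 𝕊_p ⊗ 𝒱_f^⊥ + 𝒱_h ⊗ 𝕊_m` (which forces `T[f(x) f(x)ᵀ] ∈ 𝒱_h` on `X`), and
`partialTrace T - I ∈ 𝒱_f^⊥` (which, for unit-norm `f`, says `tr T[f(x) f(x)ᵀ] = 1` on `X`). -/
def feasibleT {α β π ι : Type} [Fintype π] [Fintype ι] [DecidableEq ι]
    (X : Set α) (Y : Set β) (f : α → ι → ℝ) (h : β → π → ℝ) :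
    Set (Matrix (π × ι) (π × ι) ℝ) :=
  {T | T.PosSemidef ∧
    T ∈ tensorSpan (symMatrices π) (orthComplement (momentSpan X f)) ⊔
        tensorSpan (momentSpan Y h : Set (Matrix π π ℝ)) (symMatrices ι) ∧
    partialTrace T - 1 ∈ orthComplement (momentSpan X f)}

/-- The optimal value of the primal-dual SOS relaxation
`min_Σ max_T tr (Σ ∑_{ij} G_{ij} ⊗ T_{ij})`, where `Σ ≽ 0`, `Σ ∈ 𝒱_{f⊗f}`, `tr Σ = 1` and `T` is
feasible, for unit-norm feature maps `f` and `h`; the infimum and the supremum are taken in the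
extended reals. -/
def sosValue {α β π ι : Type} [Fintype π] [Fintype ι] [DecidableEq ι]
    (X : Set α) (Y : Set β) (f : α → ι → ℝ) (h : β → π → ℝ)
    (G : Matrix (π × ι) (π × ι) ℝ) : EReal :=
  ⨅ S ∈ pseudoMoments X (fun x => tensorSq (f x)), ⨆ T ∈ feasibleT X Y f h,
    (((S * ∑ i, ∑ j, Matrix.kronecker (block G i j) (block T i j)).trace : ℝ) : EReal)

/-! ### Approximation constants -/

/-- `δ` is an approximation constant of the feature map `P` on `X`: every Lipschitz function on `X`
is within `Lip(u) · δ` of a quadratic form in `P`. -/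
def IsApproxConst {d : ℕ} {ι : Type} [Fintype ι] (X : Set (EuclideanSpace ℝ (Fin d)))
    (P : ι → MvPolynomial (Fin d) ℝ) (δ : ℝ) : Prop :=
  ∀ (u : EuclideanSpace ℝ (Fin d) → ℝ) (L : ℝ≥0), LipschitzOnWith L u X →
    ∃ H : Matrix ι ι ℝ, ∀ x ∈ X, |u x - feat P x ⬝ᵥ (H *ᵥ feat P x)| ≤ L * δ

/-- `δ` is an SOS approximability ratio of the pair of feature maps `(P, Q)` on `X`:
matrix-valued quadratic forms `H[P Pᵀ]` with `H[P(x) P(x)ᵀ] ≽ δ ‖H‖_F I` on `X` are matrix sums of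
squares in `Q`, and scalar quadratic forms in `P ⊗ P` that are at least `δ ‖H‖_F` on `X` are sums of
squares in `Q ⊗ Q`. -/
def IsSOSRatio {d : ℕ} {ι κ : Type} [Fintype ι] [Fintype κ] (X : Set (EuclideanSpace ℝ (Fin d)))
    (P : ι → MvPolynomial (Fin d) ℝ) (Q : κ → MvPolynomial (Fin d) ℝ) (δ : ℝ) : Prop :=
  (∀ (s : ℕ) (H : Matrix (Fin s × ι) (Fin s × ι) ℝ), H.IsSymm →
    (∀ x ∈ X, (blockForm H (feat P x) -
      (δ * frobNorm H) • (1 : Matrix (Fin s) (Fin s) ℝ)).PosSemidef) →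
    ∃ A : Matrix (Fin s × κ) (Fin s × κ) ℝ, A.PosSemidef ∧
      ∀ x ∈ X, blockForm H (feat P x) = blockForm A (feat Q x)) ∧
  (∀ H : Matrix (ι × ι) (ι × ι) ℝ, H.IsSymm →
    (∀ x ∈ X, δ * frobNorm H ≤ tensorSq (feat P x) ⬝ᵥ (H *ᵥ tensorSq (feat P x))) →
    ∃ A : Matrix (κ × κ) (κ × κ) ℝ, A.PosSemidef ∧
      ∀ x ∈ X, tensorSq (feat P x) ⬝ᵥ (H *ᵥ tensorSq (feat P x)) =
        tensorSq (feat Q x) ⬝ᵥ (A *ᵥ tensorSq (feat Q x)))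

/-! ### Enlarged feature maps -/

/-- Each block `G_{ij}` is enlarged to `[[G_{ij}, 0], [0, 0]]`. -/
def padBlocks {π ι : Type} (κ : Type) (G : Matrix (π × ι) (π × ι) ℝ) :
    Matrix (π × (ι ⊕ κ)) (π × (ι ⊕ κ)) ℝ :=
  Matrix.of fun a b => Matrix.fromBlocks (block G a.1 b.1) 0 0 0 a.2 b.2

/-- The value of the primal-dual SOS relaxation after enlarging `φ` to the stacked feature map
`φ̃ = (φ, φ₁⁺, φ₂⁺)`, where `φ` has unit norm and `φ₁⁺`, `φ₂⁺` have constant squared norms `c₁`,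
`c₂`. As feature maps have unit norm, `φ̃` is divided by its constant norm `(1 + c₁ + c₂)^{1/2}` and,
so that the function `g` represented by `G` is unchanged, the padded `G` is multiplied by
`1 + c₁ + c₂`. -/
def enlargedSOSValue {d e m p m₁ m₂ : ℕ}
    (X : Set (EuclideanSpace ℝ (Fin d))) (Y : Set (EuclideanSpace ℝ (Fin e)))
    (φ : Fin m → MvPolynomial (Fin d) ℝ) (ψ : Fin p → MvPolynomial (Fin e) ℝ)
    (G : Matrix (Fin p × Fin m) (Fin p × Fin m) ℝ)
    (φ₁ : Fin m₁ → MvPolynomial (Fin d) ℝ) (c₁ : ℝ)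
    (φ₂ : Fin m₂ → MvPolynomial (Fin d) ℝ) (c₂ : ℝ) : EReal :=
  sosValue X Y
    (fun x => (Real.sqrt (1 + c₁ + c₂))⁻¹ • feat (Sum.elim (Sum.elim φ φ₁) φ₂) x)
    (feat ψ)
    ((1 + c₁ + c₂) • padBlocks (Fin m₂) (padBlocks (Fin m₁) G))

end MinMaxSOS

end

open scoped NNReal Matrix

namespace MinMaxSOS

/-! ### Quadratic forms and moment spans -/

/-! Everything is read through functions on `X`: orthogonality to the moment span means that a
quadratic form vanishes on `X`, so pairing with a pseudo-moment matrix sees only the values of the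
form on `X`.

Upper bound (`sosValue_le_minMaxValue`): insert the true moment matrix at a point x as Σ. Every
feasible T then gives a pseudo-moment matrix T[f(x)f(x)ᵀ] on `Y`, which (A1) makes a limit of
mixtures of points of `Y`, so the payoff is at most max_y g(x, y).

Lower bound (`le_sosValue`): exhibit one T that is good against every Σ. By compactness finitely
many y_k nearly attain the value everywhere; softmax weights give a smooth positive mixed response.
(A2) replaces the weights by quadratic forms, still positive and summing to one, and (A3)(i) writes
these as forms of A_k ≽ 0. Then T = ∑ ψ(y_k)ψ(y_k)ᵀ ⊗ A_k is feasible. Its payoff minus v - ε is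
strictly positive on `X`, hence a sum of squares by (A3)(ii), hence nonnegative against every Σ.

The order of choices matters: (A3) is invoked only once the matrices to be certified are fixed, so
their Frobenius norms need no a priori bound. -/

/-- The value `uᵀ M u`, as a linear functional of the matrix `M`. -/
noncomputable def quadForm {ι : Type} [Fintype ι] (u : ι → ℝ) : Matrix ι ι ℝ →ₗ[ℝ] ℝ where
  toFun M := u ⬝ᵥ (M *ᵥ u)
  map_add' M N := by rw [Matrix.add_mulVec, dotProduct_add]
  map_smul' c M := by rw [Matrix.smul_mulVec, dotProduct_smul]; rfl

section

variable {ι π κ : Type} [Fintype ι] [Fintype π] [Fintype κ]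

lemma quadForm_apply (u : ι → ℝ) (M : Matrix ι ι ℝ) : quadForm u M = u ⬝ᵥ (M *ᵥ u) := rfl

lemma quadForm_eq_sum (u : ι → ℝ) (M : Matrix ι ι ℝ) :
    quadForm u M = ∑ a, ∑ b, u a * M a b * u b := by
  simp only [quadForm_apply, dotProduct, Matrix.mulVec, Finset.mul_sum, mul_assoc]

lemma trace_outer_mul (u : ι → ℝ) (M : Matrix ι ι ℝ) :
    (outer u * M).trace = quadForm u M := by
  rw [outer, Matrix.vecMulVec_mul, Matrix.trace_vecMulVec, quadForm_apply, dotProduct_comm u,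
    dotProduct_comm, Matrix.dotProduct_mulVec]
  exact dotProduct_comm _ _

lemma quadForm_one [DecidableEq ι] (u : ι → ℝ) : quadForm u 1 = ∑ i, u i ^ 2 := by
  simp [quadForm_apply, dotProduct, sq]

lemma quadForm_transpose (u : ι → ℝ) (M : Matrix ι ι ℝ) : quadForm u Mᵀ = quadForm u M := by
  rw [quadForm_eq_sum, quadForm_eq_sum, Finset.sum_comm]
  refine Finset.sum_congr rfl fun a _ => Finset.sum_congr rfl fun b _ => ?_
  rw [Matrix.transpose_apply]; ring

lemma exists_isSymm_quadForm_eq (M : Matrix ι ι ℝ) :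
    ∃ H : Matrix ι ι ℝ, H.IsSymm ∧ ∀ u, quadForm u H = quadForm u M := by
  refine ⟨(1 / 2 : ℝ) • (M + Mᵀ), ?_, fun u => ?_⟩
  · rw [Matrix.IsSymm, Matrix.transpose_smul, Matrix.transpose_add, Matrix.transpose_transpose,
      add_comm]
  · rw [map_smul, map_add, quadForm_transpose, smul_eq_mul]; ring

lemma quadForm_smul_left (c : ℝ) (u : ι → ℝ) (M : Matrix ι ι ℝ) :
    quadForm (c • u) M = c ^ 2 * quadForm u M := by
  rw [quadForm_apply, quadForm_apply, Matrix.mulVec_smul, dotProduct_smul, smul_dotProduct,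
    smul_eq_mul, smul_eq_mul]; ring

lemma quadForm_fromBlocks (u : ι → ℝ) (v : κ → ℝ) (M : Matrix ι ι ℝ) :
    quadForm (Sum.elim u v) (Matrix.fromBlocks M 0 0 0) = quadForm u M := by
  simp [quadForm_eq_sum]

lemma tensorSq_smul {σ : Type} (c : ℝ) (u : σ → ℝ) : tensorSq (c • u) = c ^ 2 • tensorSq u := by
  ext a; simp [tensorSq]; ring

/-- This is why Σ lives on f ⊗ f: the payoff multiplies a form representing g by a form representing
the response. -/
lemma quadForm_kronecker (u : ι → ℝ) (M N : Matrix ι ι ℝ) :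
    quadForm (tensorSq u) (Matrix.kronecker M N) = quadForm u M * quadForm u N := by
  rw [quadForm_eq_sum, quadForm_eq_sum, quadForm_eq_sum, Fintype.sum_mul_sum,
    Fintype.sum_prod_type]
  refine Finset.sum_congr rfl fun a _ => Finset.sum_congr rfl fun a' _ => ?_
  rw [Fintype.sum_prod_type, Fintype.sum_mul_sum]
  refine Finset.sum_congr rfl fun b _ => Finset.sum_congr rfl fun b' _ => ?_
  simp only [tensorSq, Matrix.kronecker, Matrix.kroneckerMap_apply]
  ring

lemma sum_sq_tensorSq (u : ι → ℝ) : ∑ a, tensorSq u a ^ 2 = (∑ i, u i ^ 2) ^ 2 := by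
  rw [Fintype.sum_prod_type, sq (∑ i, u i ^ 2), Fintype.sum_mul_sum]
  simp only [tensorSq, mul_pow]

lemma posSemidef_outer (u : ι → ℝ) : (outer u).PosSemidef := by
  simpa [outer] using Matrix.posSemidef_vecMulVec_self_star u

lemma trace_outer (u : ι → ℝ) : (outer u).trace = ∑ i, u i ^ 2 := by
  simp [outer, Matrix.trace_vecMulVec, dotProduct, sq]

lemma quadForm_nonneg {M : Matrix ι ι ℝ} (hM : M.PosSemidef) (u : ι → ℝ) : 0 ≤ quadForm u M :=
  hM.dotProduct_mulVec_nonneg u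

open scoped MatrixOrder in
lemma trace_mul_nonneg {M N : Matrix ι ι ℝ} (hM : M.PosSemidef) (hN : N.PosSemidef) :
    0 ≤ (M * N).trace := by
  classical
  obtain ⟨B, rfl⟩ := CStarAlgebra.nonneg_iff_eq_star_mul_self.mp hM.nonneg
  rw [Matrix.star_eq_conjTranspose, Matrix.mul_assoc, Matrix.trace_mul_comm]
  exact (hN.mul_mul_conjTranspose_same B).trace_nonneg

lemma mem_orthComplement_momentSpan_iff {α : Type} {X : Set α} {f : α → ι → ℝ}
    {M : Matrix ι ι ℝ} :
    M ∈ orthComplement (momentSpan X f) ↔ ∀ x ∈ X, quadForm (f x) M = 0 := by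
  have key : ∀ x, (Mᵀ * outer (f x)).trace = quadForm (f x) M := fun x => by
    rw [Matrix.trace_mul_comm, trace_outer_mul, quadForm_transpose]
  constructor
  · intro h x hx
    rw [← key]
    exact h _ (Submodule.subset_span ⟨x, hx, rfl⟩)
  · intro h N hN
    induction hN using Submodule.span_induction with
    | mem N hN => obtain ⟨x, hx, rfl⟩ := hN; exact (key x).trans (h x hx)
    | zero => simp
    | add N N' _ _ h1 h2 => rw [Matrix.mul_add, Matrix.trace_add, h1, h2, add_zero]
    | smul c N _ h1 => rw [Matrix.mul_smul, Matrix.trace_smul, h1, smul_zero]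

/-- Pseudo-expectations are well defined on functions on `X`: both sides are linear in S and agree
on the generators f(x)f(x)ᵀ. -/
lemma trace_mul_eq_of_mem_momentSpan {α : Type} {X : Set α} {f : α → ι → ℝ}
    {S M N : Matrix ι ι ℝ} (hS : S ∈ momentSpan X f)
    (h : ∀ x ∈ X, quadForm (f x) M = quadForm (f x) N) :
    (S * M).trace = (S * N).trace := by
  induction hS using Submodule.span_induction with
  | mem S hS => obtain ⟨x, hx, rfl⟩ := hS; simp only [trace_outer_mul]; exact h x hx
  | zero => simp
  | add S S' _ _ h1 h2 => rw [Matrix.add_mul, Matrix.add_mul, Matrix.trace_add, Matrix.trace_add,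
      h1, h2]
  | smul c S _ h1 => rw [Matrix.smul_mul, Matrix.smul_mul, Matrix.trace_smul, Matrix.trace_smul, h1]

/-- A quadratic form that equals a constant plus a sum of squares on `X` is at least that constant
in pseudo-expectation. -/
lemma le_trace_mul_of_mem_pseudoMoments [DecidableEq ι] {α : Type} {X : Set α} {f : α → ι → ℝ}
    (hf : ∀ x ∈ X, ∑ i, f x i ^ 2 = 1) {S Q A : Matrix ι ι ℝ} (hS : S ∈ pseudoMoments X f)
    (hA : A.PosSemidef) {c : ℝ} (h : ∀ x ∈ X, quadForm (f x) Q - c = quadForm (f x) A) :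
    c ≤ (S * Q).trace := by
  have : (S * Q).trace = (S * (A + c • (1 : Matrix ι ι ℝ))).trace := by
    refine trace_mul_eq_of_mem_momentSpan hS.1 fun x hx => ?_
    rw [map_add, map_smul, quadForm_one, hf x hx, ← h x hx, smul_eq_mul]; ring
  rw [this, Matrix.mul_add, Matrix.trace_add, Matrix.mul_smul, Matrix.trace_smul, Matrix.mul_one,
    hS.2.2, smul_eq_mul, mul_one]
  linarith [trace_mul_nonneg hS.2.1 hA]

lemma outer_mem_pseudoMoments {α : Type} {X : Set α} {f : α → ι → ℝ} {x : α} (hx : x ∈ X)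
    (hf : ∑ i, f x i ^ 2 = 1) : outer (f x) ∈ pseudoMoments X f :=
  ⟨Submodule.subset_span ⟨x, hx, rfl⟩, posSemidef_outer _, (trace_outer _).trans hf⟩

/-! ### Block matrices -/

lemma quadForm_tensorSq_sum_kronecker (u : ι → ℝ) (G T : Matrix (π × ι) (π × ι) ℝ) :
    quadForm (tensorSq u) (∑ i, ∑ j, Matrix.kronecker (block G i j) (block T i j)) =
      ∑ i, ∑ j, quadForm u (block G i j) * quadForm u (block T i j) := by
  simp only [map_sum, quadForm_kronecker]

lemma trace_mul_kronecker_outer (G : Matrix (π × ι) (π × ι) ℝ) (v : π → ℝ) (u : ι → ℝ) :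
    (G * Matrix.kronecker (outer v) (outer u)).trace =
      ∑ i, ∑ j, quadForm u (block G i j) * outer v i j := by
  have : Matrix.kronecker (outer v) (outer u) = outer fun a : π × ι => v a.1 * u a.2 := by
    ext a b
    simp only [outer, Matrix.kronecker, Matrix.kroneckerMap_apply, Matrix.vecMulVec_apply]; ring
  rw [this, Matrix.trace_mul_comm, trace_outer_mul, quadForm_eq_sum]
  simp only [Fintype.sum_prod_type, quadForm_eq_sum, Finset.sum_mul]
  refine Finset.sum_congr rfl fun i _ => ?_
  rw [Finset.sum_comm]
  refine Finset.sum_congr rfl fun j _ => Finset.sum_congr rfl fun a _ =>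
    Finset.sum_congr rfl fun b _ => ?_
  simp only [outer, Matrix.vecMulVec_apply, block, Matrix.of_apply]; ring

/-- Testing against v gives the form of T at v ⊗ u. -/
lemma posSemidef_blockForm {T : Matrix (π × ι) (π × ι) ℝ} (hT : T.PosSemidef) (u : ι → ℝ) :
    (blockForm T u).PosSemidef := by
  refine .of_dotProduct_mulVec_nonneg ?_ fun v => ?_
  · ext i j
    have h : ∀ a b, T a b = T b a := fun a b => by simpa using (hT.1.apply b a)
    change quadForm u (block T j i) = quadForm u (block T i j)
    rw [← quadForm_transpose]
    congr 1
    ext a b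
    exact h _ _
  · have h := quadForm_nonneg hT fun a : π × ι => v a.1 * u a.2
    have e : quadForm v (blockForm T u) = quadForm (fun a : π × ι => v a.1 * u a.2) T := by
      rw [quadForm_eq_sum, quadForm_eq_sum]
      simp only [Fintype.sum_prod_type]
      refine Finset.sum_congr rfl fun i _ => ?_
      rw [Finset.sum_comm]
      refine Finset.sum_congr rfl fun j _ => ?_
      change v i * quadForm u (block T i j) * v j = _
      rw [quadForm_eq_sum, Finset.mul_sum, Finset.sum_mul]
      refine Finset.sum_congr rfl fun a _ => ?_
      rw [Finset.mul_sum, Finset.sum_mul]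
      refine Finset.sum_congr rfl fun b _ => ?_
      simp only [block, Matrix.of_apply]; ring
    exact h.trans_eq e.symm

lemma trace_blockForm (T : Matrix (π × ι) (π × ι) ℝ) (u : ι → ℝ) :
    (blockForm T u).trace = quadForm u (partialTrace T) := by
  rw [partialTrace, map_sum]; rfl

lemma blockForm_kronecker {ρ : Type} (N : Matrix ρ ρ ℝ) (M : Matrix ι ι ℝ) (u : ι → ℝ) :
    blockForm (Matrix.kronecker N M) u = quadForm u M • N := by
  ext i j
  change quadForm u (block _ i j) = _
  have : block (Matrix.kronecker N M) i j = N i j • M := by ext; rfl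
  rw [this, map_smul, Matrix.smul_apply, smul_eq_mul, smul_eq_mul, mul_comm]

/-- `blockForm` as a linear map in the block matrix. -/
noncomputable def blockFormHom (π : Type) (u : ι → ℝ) :
    Matrix (π × ι) (π × ι) ℝ →ₗ[ℝ] Matrix π π ℝ where
  toFun T := blockForm T u
  map_add' T T' := by ext i j; exact map_add (quadForm u) (block T i j) (block T' i j)
  map_smul' c T := by ext i j; exact map_smul (quadForm u) c (block T i j)

/-- At a point of `X` the 𝒱_f^⊥ summand evaluates to zero and the other lands in 𝒱_h; the partial
trace condition fixes the trace. -/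
lemma blockForm_mem_pseudoMoments [DecidableEq ι] {α β : Type} {X : Set α} {Y : Set β}
    {f : α → ι → ℝ} {h : β → π → ℝ} {T : Matrix (π × ι) (π × ι) ℝ} (hT : T ∈ feasibleT X Y f h)
    {x : α} (hx : x ∈ X) (hf : ∑ i, f x i ^ 2 = 1) :
    blockForm T (f x) ∈ pseudoMoments Y h := by
  obtain ⟨h1, h2, h3⟩ := hT
  refine ⟨?_, posSemidef_blockForm h1 _, ?_⟩
  · have : tensorSpan (symMatrices π) (orthComplement (momentSpan X f)) ⊔
        tensorSpan (momentSpan Y h : Set (Matrix π π ℝ)) (symMatrices ι) ≤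
        (momentSpan Y h).comap (blockFormHom π (f x)) := by
      refine sup_le (Submodule.span_le.2 ?_) (Submodule.span_le.2 ?_)
      · rintro _ ⟨N, -, M, hM, rfl⟩
        change blockForm _ _ ∈ momentSpan Y h
        rw [blockForm_kronecker, mem_orthComplement_momentSpan_iff.1 hM x hx, zero_smul]
        exact zero_mem _
      · rintro _ ⟨N, hN, M, -, rfl⟩
        change blockForm _ _ ∈ momentSpan Y h
        rw [blockForm_kronecker]
        exact Submodule.smul_mem _ _ hN
    exact this h2
  · have := mem_orthComplement_momentSpan_iff.1 h3 x hx
    rw [map_sub, quadForm_one, hf] at this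
    rw [trace_blockForm]; linarith

/-- The matrices `∑_k v_k v_kᵀ ⊗ A_k` with `A_k ≽ 0` are feasible as soon as the functions
`f(x)ᵀ A_k f(x)` sum to one on `X`. -/
lemma sum_kronecker_mem_feasibleT [DecidableEq ι] {α β : Type} {X : Set α} {Y : Set β}
    {f : α → ι → ℝ} {h : β → π → ℝ} (hf : ∀ x ∈ X, ∑ i, f x i ^ 2 = 1)
    (y : κ → β) (hy : ∀ k, y k ∈ Y) (hh : ∀ k, ∑ i, h (y k) i ^ 2 = 1)
    (A : κ → Matrix ι ι ℝ) (hA : ∀ k, (A k).PosSemidef)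
    (hsum : ∀ x ∈ X, ∑ k, quadForm (f x) (A k) = 1) :
    ∑ k, Matrix.kronecker (outer (h (y k))) (A k) ∈ feasibleT X Y f h := by
  classical
  refine ⟨?_, ?_, ?_⟩
  · exact Matrix.posSemidef_sum _ fun k _ => (posSemidef_outer _).kronecker (hA k)
  · refine Submodule.mem_sup_right (Submodule.sum_mem _ fun k _ => Submodule.subset_span ?_)
    refine ⟨_, Submodule.subset_span ⟨y k, hy k, rfl⟩, A k, ?_, rfl⟩
    simpa [symMatrices, Matrix.IsSymm, Matrix.IsHermitian] using (hA k).1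
  · rw [mem_orthComplement_momentSpan_iff]
    intro x hx
    rw [map_sub, quadForm_one, hf x hx, ← trace_blockForm]
    change (blockFormHom π (f x) _).trace - 1 = 0
    rw [map_sum, Matrix.trace_sum, sub_eq_zero, ← hsum x hx]
    refine Finset.sum_congr rfl fun k _ => ?_
    change (blockForm _ _).trace = _
    rw [blockForm_kronecker, Matrix.trace_smul, trace_outer, hh, smul_eq_mul, mul_one]

end

/-! ### Approximate maximizers -/

/-- Each y wins on a relatively open subset of `X`; extract a finite subcover. -/
lemma exists_finset_forall_exists_lt {α β : Type} [TopologicalSpace α] {X : Set α} {Y : Set β}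
    (hX : IsCompact X) {h : α → β → ℝ} (hc : ∀ y ∈ Y, ContinuousOn (h · y) X) {c : ℝ}
    (H : ∀ x ∈ X, ∃ y ∈ Y, c < h x y) :
    ∃ t : Finset β, ↑t ⊆ Y ∧ ∀ x ∈ X, ∃ y ∈ t, c < h x y := by
  classical
  refine hX.induction_on (p := fun s => ∃ t : Finset β, ↑t ⊆ Y ∧ ∀ x ∈ s, ∃ y ∈ t, c < h x y)
    ⟨∅, by simp, by simp⟩ ?_ ?_ ?_
  · rintro s s' hs ⟨t, ht, h1⟩
    exact ⟨t, ht, fun x hx => h1 x (hs hx)⟩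
  · rintro s s' ⟨t, ht, h1⟩ ⟨t', ht', h1'⟩
    refine ⟨t ∪ t', by simp [ht, ht'], ?_⟩
    rintro x (hx | hx)
    · obtain ⟨y, hy, hxy⟩ := h1 x hx
      exact ⟨y, Finset.mem_union_left _ hy, hxy⟩
    · obtain ⟨y, hy, hxy⟩ := h1' x hx
      exact ⟨y, Finset.mem_union_right _ hy, hxy⟩
  · intro x hx
    obtain ⟨y, hy, hxy⟩ := H x hx
    refine ⟨{x | c < h x y}, (hc y hy x hx).eventually (lt_mem_nhds hxy), {y}, by simpa using hy,
      fun x hx => ⟨y, by simp, hx⟩⟩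

/-- Softmax weights: smooth positive weights that sum to one and nearly concentrate on the large
values. -/
lemma exists_smooth_weights {E κ : Type} [NormedAddCommGroup E] [NormedSpace ℝ E] [Fintype κ]
    [Nonempty κ] (g : κ → E → ℝ) (hg : ∀ k, ContDiff ℝ 1 (g k)) {η : ℝ} (hη : 0 < η) :
    ∃ w : κ → E → ℝ, (∀ k, ContDiff ℝ 1 (w k)) ∧ (∀ k x, 0 < w k x) ∧ (∀ x, ∑ k, w k x = 1) ∧
      ∀ x j, g j x - η ≤ ∑ k, w k x * g k x := by
  -- Each of the card κ terms of the softmax loss is at most 1/β, so this β makes the total η.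
  set β : ℝ := Fintype.card κ / η with hβ
  have hcard : (0 : ℝ) < Fintype.card κ := by exact_mod_cast Fintype.card_pos
  have hβ0 : 0 < β := by positivity
  have hs : ∀ x, 0 < ∑ k, Real.exp (β * g k x) := fun x =>
    Finset.sum_pos (fun k _ => Real.exp_pos _) Finset.univ_nonempty
  have hsum : ∀ x, ∑ k, Real.exp (β * g k x) / ∑ k, Real.exp (β * g k x) = 1 := fun x => by
    rw [← Finset.sum_div, div_self (hs x).ne']
  refine ⟨fun k x => Real.exp (β * g k x) / ∑ k, Real.exp (β * g k x), fun k => ?_, fun k x => ?_,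
    hsum, fun x j => ?_⟩
  · refine ContDiff.div (Real.contDiff_exp.comp (contDiff_const.mul (hg k)))
      (ContDiff.sum fun k _ => Real.contDiff_exp.comp (contDiff_const.mul (hg k)))
      fun x => (hs x).ne'
  · exact div_pos (Real.exp_pos _) (hs x)
  -- For g_k ≤ g_j, apply t ≤ exp t to t = β(g_j - g_k) and bound exp(β g_j) by the normalizing sum.
  · have key : ∀ k, Real.exp (β * g k x) / (∑ k, Real.exp (β * g k x)) * (g j x - g k x) ≤
        β⁻¹ := fun k => by
      rcases le_total (g j x) (g k x) with h | h
      · exact (mul_nonpos_of_nonneg_of_nonpos (div_pos (Real.exp_pos _) (hs x)).le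
          (sub_nonpos.2 h)).trans (inv_pos.2 hβ0).le
      · have h1 : Real.exp (β * g j x) ≤ ∑ k, Real.exp (β * g k x) :=
          Finset.single_le_sum (f := fun k => Real.exp (β * g k x))
            (fun k _ => (Real.exp_pos _).le) (Finset.mem_univ j)
        have h2 : β * (g j x - g k x) + 1 ≤ Real.exp (β * (g j x - g k x)) := Real.add_one_le_exp _
        rw [div_mul_eq_mul_div, div_le_iff₀ (hs x)]
        have h3 : Real.exp (β * g k x) * Real.exp (β * (g j x - g k x)) = Real.exp (β * g j x) := by
          rw [← Real.exp_add]; congr 1; ring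
        have h4 : Real.exp (β * g k x) * (β * (g j x - g k x)) ≤ Real.exp (β * g j x) := by
          rw [← h3]
          exact mul_le_mul_of_nonneg_left (by linarith) (Real.exp_pos _).le
        rw [← div_eq_inv_mul, le_div_iff₀ hβ0]
        linarith
    have h5 : ∑ k, Real.exp (β * g k x) / (∑ k, Real.exp (β * g k x)) * (g j x - g k x) ≤ η := by
      refine (Finset.sum_le_sum fun k _ => key k).trans_eq ?_
      rw [Finset.sum_const, Finset.card_univ, nsmul_eq_mul, hβ]
      field_simp
    simp only [mul_sub, Finset.sum_sub_distrib, ← Finset.sum_mul, hsum x, one_mul] at h5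
    linarith

/-! ### Feature maps -/

lemma contDiff_feat {d : ℕ} {ι : Type} (P : ι → MvPolynomial (Fin d) ℝ) (i : ι) :
    ContDiff ℝ 1 fun x => feat P x i := by
  simp only [feat]
  induction P i using MvPolynomial.induction_on with
  | C a => simpa using contDiff_const
  | add p q hp hq => simpa using hp.add hq
  | mul_X p j hp => simpa using hp.mul (by fun_prop)

lemma contDiff_quadForm_feat {d : ℕ} {ι : Type} [Fintype ι] (P : ι → MvPolynomial (Fin d) ℝ)
    (M : Matrix ι ι ℝ) : ContDiff ℝ 1 fun x => quadForm (feat P x) M := by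
  simp only [quadForm_eq_sum]
  exact ContDiff.sum fun a _ => ContDiff.sum fun b _ =>
    ((contDiff_feat P a).mul contDiff_const).mul (contDiff_feat P b)

lemma feat_sumElim {d : ℕ} {ι κ : Type} (P : ι → MvPolynomial (Fin d) ℝ)
    (Q : κ → MvPolynomial (Fin d) ℝ) (x : EuclideanSpace ℝ (Fin d)) :
    feat (Sum.elim P Q) x = Sum.elim (feat P x) (feat Q x) := by
  ext (i | i) <;> rfl

lemma HasSqNorm.sumElim {d : ℕ} {ι κ : Type} [Fintype ι] [Fintype κ]
    {X : Set (EuclideanSpace ℝ (Fin d))} {P : ι → MvPolynomial (Fin d) ℝ}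
    {Q : κ → MvPolynomial (Fin d) ℝ} {a b : ℝ} (hP : HasSqNorm X P a) (hQ : HasSqNorm X Q b) :
    HasSqNorm X (Sum.elim P Q) (a + b) := fun x hx => by
  rw [feat_sumElim, Fintype.sum_sum_type]
  exact congrArg₂ _ (hP x hx) (hQ x hx)

lemma HasSqNorm.nonneg {d : ℕ} {ι : Type} [Fintype ι] {X : Set (EuclideanSpace ℝ (Fin d))}
    {P : ι → MvPolynomial (Fin d) ℝ} {c : ℝ} (h : HasSqNorm X P c) (hX : X.Nonempty) : 0 ≤ c := by
  obtain ⟨x, hx⟩ := hX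
  rw [← h x hx]
  exact Finset.sum_nonneg fun i _ => sq_nonneg _

/-- Positive smooth weights summing to one can be approximated by positive quadratic forms summing
to one. -/
lemma exists_quadForm_weights {d : ℕ} {ι κ : Type} [Fintype ι] [Fintype κ] [Nonempty κ]
    {X : Set (EuclideanSpace ℝ (Fin d))} {w : κ → EuclideanSpace ℝ (Fin d) → ℝ}
    (hsum : ∀ x, ∑ k, w k x = 1) {L : ℝ≥0} (hw : ∀ k, LipschitzOnWith L (w k) X)
    {P : ι → MvPolynomial (Fin d) ℝ} {δ : ℝ} (hP : IsApproxConst X P δ)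
    {I : Matrix ι ι ℝ} (hI : ∀ x ∈ X, quadForm (feat P x) I = 1) :
    ∃ H : κ → Matrix ι ι ℝ, (∀ k, (H k).IsSymm) ∧
      (∀ x ∈ X, ∑ k, quadForm (feat P x) (H k) = 1) ∧
      ∀ k, ∀ x ∈ X, |w k x - quadForm (feat P x) (H k)| ≤ 2 * (L * δ) := by
  choose H₀ hH₀ using fun k => hP (w k) L (hw k)
  have hcard : (0 : ℝ) < Fintype.card κ := by exact_mod_cast Fintype.card_pos
  -- The defect in the sum is shared equally among the forms. As the weights sum to one, each
  -- correction is the mean approximation error, which accounts for the factor 2.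
  choose H hHs hH using fun k => exists_isSymm_quadForm_eq
    (H₀ k + (Fintype.card κ : ℝ)⁻¹ • (I - ∑ j, H₀ j))
  have hq : ∀ x ∈ X, ∀ k, quadForm (feat P x) (H k) = quadForm (feat P x) (H₀ k) +
      (Fintype.card κ : ℝ)⁻¹ * ∑ j, (w j x - quadForm (feat P x) (H₀ j)) := fun x hx k => by
    rw [hH, map_add, map_smul, map_sub, hI x hx, map_sum, smul_eq_mul, Finset.sum_sub_distrib, hsum]
  refine ⟨H, hHs, fun x hx => ?_, fun k x hx => ?_⟩
  · simp only [hq x hx, Finset.sum_add_distrib, Finset.sum_const, Finset.card_univ, nsmul_eq_mul,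
      mul_inv_cancel_left₀ hcard.ne', Finset.sum_sub_distrib, hsum]
    ring
  · have h1 : |(Fintype.card κ : ℝ)⁻¹ * ∑ j, (w j x - quadForm (feat P x) (H₀ j))| ≤ L * δ := by
      rw [abs_mul, abs_of_pos (inv_pos.2 hcard), inv_mul_le_iff₀ hcard]
      refine (Finset.abs_sum_le_sum_abs _ _).trans
        ((Finset.sum_le_sum fun j _ => hH₀ j x hx).trans_eq ?_)
      rw [Finset.sum_const, Finset.card_univ, nsmul_eq_mul]
    have h2 : |w k x - quadForm (feat P x) (H₀ k)| ≤ L * δ := hH₀ k x hx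
    rw [hq x hx]
    rw [abs_le] at h1 h2 ⊢
    constructor <;> linarith [h1.1, h1.2, h2.1, h2.2]

/-- The scalar case of the matrix-valued part of `IsSOSRatio`. -/
lemma IsSOSRatio.exists_posSemidef {d : ℕ} {ι κ : Type} [Fintype ι] [Fintype κ]
    {X : Set (EuclideanSpace ℝ (Fin d))} {P : ι → MvPolynomial (Fin d) ℝ}
    {Q : κ → MvPolynomial (Fin d) ℝ} {δ : ℝ} (h : IsSOSRatio X P Q δ) {H : Matrix ι ι ℝ}
    (hH : H.IsSymm) (hpos : ∀ x ∈ X, δ * frobNorm H ≤ quadForm (feat P x) H) :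
    ∃ A : Matrix κ κ ℝ, A.PosSemidef ∧
      ∀ x ∈ X, quadForm (feat P x) H = quadForm (feat Q x) A := by
  have hb : ∀ u : ι → ℝ, blockForm (H.submatrix Prod.snd Prod.snd : Matrix (Fin 1 × ι) _ ℝ) u =
      quadForm u H • (1 : Matrix (Fin 1) (Fin 1) ℝ) := fun u => by
    ext i j
    rw [Subsingleton.elim i j]
    simp only [Matrix.smul_apply, Matrix.one_apply_eq, smul_eq_mul, mul_one]
    rfl
  have hn : frobNorm (H.submatrix Prod.snd Prod.snd : Matrix (Fin 1 × ι) _ ℝ) = frobNorm H := by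
    simp [frobNorm, Fintype.sum_prod_type]
  obtain ⟨A, hA, hAH⟩ := h.1 1 (H.submatrix Prod.snd Prod.snd) (hH.submatrix _) fun x hx => by
    rw [hb, hn, ← sub_smul]
    exact Matrix.PosSemidef.one.smul (sub_nonneg.2 (hpos x hx))
  refine ⟨A.submatrix (Prod.mk 0) (Prod.mk 0), hA.submatrix _, fun x hx => ?_⟩
  have := congrFun (congrFun (hAH x hx) 0) 0
  rw [hb, Matrix.smul_apply, Matrix.one_apply_eq, smul_eq_mul, mul_one] at this
  exact this

/-! ### Bounds on the relaxation -/

/-- The function `(x, y) ↦ tr (G (h hᵀ ⊗ f fᵀ))` at `u = f(x)`, `v = h(y)`. -/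
noncomputable def payoff {π ι : Type} [Fintype π] [Fintype ι] (G : Matrix (π × ι) (π × ι) ℝ)
    (u : ι → ℝ) (v : π → ℝ) : ℝ :=
  ∑ i, ∑ j, quadForm u (block G i j) * outer v i j

section

variable {α β π ι : Type} [Fintype π] [Fintype ι] [DecidableEq ι] {X : Set α} {Y : Set β}
  {f : α → ι → ℝ} {h : β → π → ℝ} {G : Matrix (π × ι) (π × ι) ℝ}

lemma sosValue_le_minMaxValue (hf : ∀ x ∈ X, ∑ i, f x i ^ 2 = 1)
    (hY : pseudoMoments Y h ⊆ momentHull Y h)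
    (hmax : ∀ x ∈ X, ∃ y ∈ Y, ∀ y' ∈ Y, payoff G (f x) (h y') ≤ payoff G (f x) (h y)) :
    sosValue X Y f h G ≤ minMaxValue X Y fun x y => payoff G (f x) (h y) := by
  refine le_iInf₂ fun x hx => ?_
  have hmem : outer (tensorSq (f x)) ∈ pseudoMoments X fun x => tensorSq (f x) :=
    outer_mem_pseudoMoments (f := fun x => tensorSq (f x)) hx
      (by rw [sum_sq_tensorSq, hf x hx, one_pow])
  refine (iInf₂_le _ hmem).trans (iSup₂_le fun T hT => ?_)
  obtain ⟨y, hy, hxy⟩ := hmax x hx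
  refine le_trans ?_ (le_iSup₂ (f := fun y (_ : y ∈ Y) => (payoff G (f x) (h y) : EReal)) y hy)
  rw [EReal.coe_le_coe_iff, trace_outer_mul, quadForm_tensorSq_sum_kronecker]
  -- For fixed x the payoff is linear in the matrix on `Y`, so a bound at rank-one moments extends
  -- to their closed convex hull.
  have hsub : momentHull Y h ⊆
      {M | ∑ i, ∑ j, quadForm (f x) (block G i j) * M i j ≤ payoff G (f x) (h y)} := by
    refine closure_minimal (convexHull_min ?_ ?_) ?_
    · rintro _ ⟨y', hy', rfl⟩
      exact hxy y' hy'
    · refine convex_halfSpace_le (f := fun M : Matrix π π ℝ =>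
        ∑ i, ∑ j, quadForm (f x) (block G i j) * M i j) ⟨fun M N => ?_, fun c M => ?_⟩ _
      · simp only [Matrix.add_apply, mul_add, Finset.sum_add_distrib]
      · simp only [Matrix.smul_apply, smul_eq_mul, Finset.mul_sum, mul_left_comm]
    · refine isClosed_le (continuous_finsetSum _ fun i _ => continuous_finsetSum _ fun j _ =>
        continuous_const.mul ?_) continuous_const
      exact (continuous_apply j).comp (continuous_apply i)
  exact hsub (hY (blockForm_mem_pseudoMoments hT hx (hf x hx)))

lemma le_sosValue {κ : Type} [Fintype κ] (hf : ∀ x ∈ X, ∑ i, f x i ^ 2 = 1)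
    {y : κ → β} (hy : ∀ k, y k ∈ Y) (hh : ∀ k, ∑ i, h (y k) i ^ 2 = 1)
    {A : κ → Matrix ι ι ℝ} (hA : ∀ k, (A k).PosSemidef)
    (hsum : ∀ x ∈ X, ∑ k, quadForm (f x) (A k) = 1)
    {B : Matrix (ι × ι) (ι × ι) ℝ} (hB : B.PosSemidef) {c : ℝ}
    (hc : ∀ x ∈ X, ∑ k, payoff G (f x) (h (y k)) * quadForm (f x) (A k) - c =
      quadForm (tensorSq (f x)) B) :
    (c : EReal) ≤ sosValue X Y f h G := by
  refine le_iInf₂ fun S hS => ?_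
  refine le_trans ?_ (le_iSup₂ _ (sum_kronecker_mem_feasibleT hf y hy hh A hA hsum))
  rw [EReal.coe_le_coe_iff]
  refine le_trace_mul_of_mem_pseudoMoments (f := fun x => tensorSq (f x))
    (fun x hx => by rw [sum_sq_tensorSq, hf x hx, one_pow]) hS hB fun x hx => ?_
  rw [← hc x hx, quadForm_tensorSq_sum_kronecker]
  congr 1
  have hT : ∀ i j, quadForm (f x)
      (block (∑ k, Matrix.kronecker (outer (h (y k))) (A k)) i j) =
      ∑ k, quadForm (f x) (A k) * outer (h (y k)) i j := fun i j => by
    change blockFormHom π (f x) _ i j = _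
    rw [map_sum, Matrix.sum_apply]
    refine Finset.sum_congr rfl fun k _ => ?_
    change blockForm _ _ i j = _
    rw [blockForm_kronecker]; rfl
  simp only [hT, payoff, Finset.sum_mul, Finset.mul_sum]
  symm
  rw [Finset.sum_comm]
  refine Finset.sum_congr rfl fun i _ => ?_
  rw [Finset.sum_comm]
  exact Finset.sum_congr rfl fun j _ => Finset.sum_congr rfl fun k _ => by ring

end

/-! ### Payoffs under padding and rescaling -/

lemma block_padBlocks {π ι : Type} (κ : Type) (G : Matrix (π × ι) (π × ι) ℝ) (i j : π) :
    block (padBlocks κ G) i j = Matrix.fromBlocks (block G i j) 0 0 0 := rfl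

lemma payoff_smul_padBlocks {π ι κ κ' : Type} [Fintype π] [Fintype ι] [Fintype κ] [Fintype κ']
    (G : Matrix (π × ι) (π × ι) ℝ) (u : ι → ℝ) (u' : κ → ℝ) (u'' : κ' → ℝ) (v : π → ℝ) {c : ℝ}
    (hc : 0 < c) :
    payoff (c • padBlocks κ' (padBlocks κ G))
      ((Real.sqrt c)⁻¹ • Sum.elim (Sum.elim u u') u'') v = payoff G u v := by
  refine Finset.sum_congr rfl fun i _ => Finset.sum_congr rfl fun j _ => ?_
  have : block (c • padBlocks κ' (padBlocks κ G)) i j =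
      c • block (padBlocks κ' (padBlocks κ G)) i j := rfl
  rw [this, map_smul, quadForm_smul_left, block_padBlocks, quadForm_fromBlocks, block_padBlocks,
    quadForm_fromBlocks, inv_pow, Real.sq_sqrt hc.le, smul_eq_mul, mul_inv_cancel_left₀ hc.ne']

lemma payoff_eq_quadForm {π ι : Type} [Fintype π] [Fintype ι] (G : Matrix (π × ι) (π × ι) ℝ)
    (u : ι → ℝ) (v : π → ℝ) :
    payoff G u v = quadForm u (∑ i, ∑ j, outer v i j • block G i j) := by
  simp only [payoff, map_sum, map_smul, smul_eq_mul, mul_comm]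

lemma contDiff_payoff_left {d : ℕ} {π ι : Type} [Fintype π] [Fintype ι]
    (G : Matrix (π × ι) (π × ι) ℝ) (P : ι → MvPolynomial (Fin d) ℝ) (v : π → ℝ) :
    ContDiff ℝ 1 fun x => payoff G (feat P x) v := by
  simp only [payoff_eq_quadForm]
  exact contDiff_quadForm_feat _ _

lemma continuous_payoff_right {e : ℕ} {π ι : Type} [Fintype π] [Fintype ι]
    (G : Matrix (π × ι) (π × ι) ℝ) (u : ι → ℝ) (P : π → MvPolynomial (Fin e) ℝ) :
    Continuous fun y => payoff G u (feat P y) := by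
  refine continuous_finsetSum _ fun i _ => continuous_finsetSum _ fun j _ =>
    continuous_const.mul ?_
  exact (contDiff_feat P i).continuous.mul (contDiff_feat P j).continuous

/-! ### Uniform constants -/

/-- The sum of the reciprocals is continuous, hence bounded on `X`; this also covers empty `X` or κ.
-/
lemma exists_pos_le_of_isCompact {E κ : Type} [TopologicalSpace E] [Fintype κ] {X : Set E}
    (hX : IsCompact X) {w : κ → E → ℝ} (hw : ∀ k, Continuous (w k)) (hpos : ∀ k x, 0 < w k x) :
    ∃ μ : ℝ, 0 < μ ∧ ∀ k, ∀ x ∈ X, μ ≤ w k x := by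
  obtain ⟨C, hC⟩ := hX.bddAbove_image (f := fun x => ∑ k, (w k x)⁻¹)
    (continuous_finsetSum _ fun k _ => (hw k).inv₀ fun x => (hpos k x).ne').continuousOn
  refine ⟨(max C 1)⁻¹, by positivity, fun k x hx => ?_⟩
  rw [inv_le_comm₀ (by positivity) (hpos k x)]
  exact ((Finset.single_le_sum (f := fun k => (w k x)⁻¹)
    (fun k _ => (inv_pos.2 (hpos k x)).le) (Finset.mem_univ k)).trans
    (hC ⟨x, hx, rfl⟩)).trans (le_max_left _ _)

lemma exists_lipschitzOnWith_of_contDiff {E κ : Type} [NormedAddCommGroup E] [NormedSpace ℝ E]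
    [Fintype κ] {X : Set E} (hX : IsCompact X) {w : κ → E → ℝ} (hw : ∀ k, ContDiff ℝ 1 (w k)) :
    ∃ L : ℝ≥0, ∀ k, LipschitzOnWith L (w k) X := by
  choose L hL using fun k =>
    ((hw k).locallyLipschitz.locallyLipschitzOn (s := X)).exists_lipschitzOnWith_of_compact hX
  exact ⟨∑ k, L k, fun k => (hL k).weaken (Finset.single_le_sum (fun _ _ => zero_le)
    (Finset.mem_univ k))⟩

lemma exists_pos_mul_frobNorm_le {κ : Type} [Fintype κ] {ι : Type} [Fintype ι]
    (H : κ → Matrix ι ι ℝ) {c : ℝ} (hc : 0 < c) :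
    ∃ δ : ℝ, 0 < δ ∧ ∀ k, δ * frobNorm (H k) ≤ c := by
  have h0 : ∀ k, 0 ≤ frobNorm (H k) := fun k => Real.sqrt_nonneg _
  have hs : 0 ≤ ∑ k, frobNorm (H k) := Finset.sum_nonneg fun k _ => h0 k
  refine ⟨c / (∑ k, frobNorm (H k) + 1), by positivity, fun k => ?_⟩
  rw [div_mul_eq_mul_div, div_le_iff₀ (by positivity)]
  refine mul_le_mul_of_nonneg_left ?_ hc.le
  linarith [Finset.single_le_sum (fun k _ => h0 k) (Finset.mem_univ k)]

end MinMaxSOS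

/-! ### Assembling the two bounds -/

open MinMaxSOS in
theorem mainTheorem1 {d e m p : ℕ}
    (X : Set (EuclideanSpace ℝ (Fin d))) (hX : IsCompact X) (hXne : X.Nonempty)
    (Y : Set (EuclideanSpace ℝ (Fin e))) (hY : IsCompact Y) (hYne : Y.Nonempty)
    (φ : Fin m → MvPolynomial (Fin d) ℝ) (hφ : MinMaxSOS.HasSqNorm X φ 1)
    (ψ : Fin p → MvPolynomial (Fin e) ℝ) (hψ : MinMaxSOS.HasSqNorm Y ψ 1)
    (G : Matrix (Fin p × Fin m) (Fin p × Fin m) ℝ) (hG : G.IsSymm)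
    (g : EuclideanSpace ℝ (Fin d) → EuclideanSpace ℝ (Fin e) → ℝ)
    (hg : ∀ x ∈ X, ∀ y ∈ Y, g x y =
      (G * Matrix.kronecker (MinMaxSOS.outer (MinMaxSOS.feat ψ y))
        (MinMaxSOS.outer (MinMaxSOS.feat φ x))).trace)
    (A1 : MinMaxSOS.pseudoMoments Y (MinMaxSOS.feat ψ) =
      MinMaxSOS.momentHull Y (MinMaxSOS.feat ψ))
    (A2 : ∀ δ : ℝ, 0 < δ →
      ∃ (m₁ : ℕ) (φ₁ : Fin m₁ → MvPolynomial (Fin d) ℝ) (c₁ : ℝ),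
        MinMaxSOS.HasSqNorm X φ₁ c₁ ∧ MinMaxSOS.IsApproxConst X (Sum.elim φ φ₁) δ)
    (A3 : ∀ (m₁ : ℕ) (φ₁ : Fin m₁ → MvPolynomial (Fin d) ℝ) (c₁ : ℝ),
      MinMaxSOS.HasSqNorm X φ₁ c₁ → ∀ δ : ℝ, 0 < δ →
      ∃ (m₂ : ℕ) (φ₂ : Fin m₂ → MvPolynomial (Fin d) ℝ) (c₂ : ℝ),
        MinMaxSOS.HasSqNorm X φ₂ c₂ ∧
        MinMaxSOS.IsSOSRatio X (Sum.elim φ φ₁) (Sum.elim (Sum.elim φ φ₁) φ₂) δ)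
    (ε : ℝ) (hε : 0 < ε) :
    ∃ (m₁ : ℕ) (φ₁ : Fin m₁ → MvPolynomial (Fin d) ℝ) (c₁ : ℝ)
      (m₂ : ℕ) (φ₂ : Fin m₂ → MvPolynomial (Fin d) ℝ) (c₂ : ℝ),
      MinMaxSOS.HasSqNorm X φ₁ c₁ ∧ MinMaxSOS.HasSqNorm X φ₂ c₂ ∧
      ∃ v w : ℝ, MinMaxSOS.minMaxValue X Y g = (v : EReal) ∧
        MinMaxSOS.enlargedSOSValue X Y φ ψ G φ₁ c₁ φ₂ c₂ = (w : EReal) ∧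
        |w - v| ≤ ε := by
  classical
  have hpay : ∀ x ∈ X, ∀ y ∈ Y, g x y = payoff G (feat φ x) (feat ψ y) := fun x hx y hy => by
    rw [hg x hx y hy, trace_mul_kronecker_outer]; rfl
  have hmax : ∀ x ∈ X, ∃ y ∈ Y, ∀ y' ∈ Y,
      payoff G (feat φ x) (feat ψ y') ≤ payoff G (feat φ x) (feat ψ y) := fun x _ =>
    hY.exists_isMaxOn hYne (continuous_payoff_right G (feat φ x) ψ).continuousOn
  have hvalue : minMaxValue X Y g =
      minMaxValue X Y fun x y => payoff G (feat φ x) (feat ψ y) :=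
    biInf_congr fun x hx => biSup_congr fun y hy => by rw [hpay x hx y hy]
  rw [hvalue]
  obtain ⟨v, hv⟩ : ∃ v : ℝ, minMaxValue X Y (fun x y => payoff G (feat φ x) (feat ψ y)) = v := by
    obtain ⟨x₀, hx₀⟩ := hXne
    obtain ⟨y₀, hy₀⟩ := hYne
    obtain ⟨y₁, -, hy₁⟩ := hmax x₀ hx₀
    obtain ⟨x₁, -, hx₁⟩ := hX.exists_isMinOn ⟨x₀, hx₀⟩
      (contDiff_payoff_left G φ (feat ψ y₀)).continuous.continuousOn
    have hle : minMaxValue X Y (fun x y => payoff G (feat φ x) (feat ψ y)) ≤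
        (payoff G (feat φ x₀) (feat ψ y₁) : ℝ) :=
      (iInf₂_le x₀ hx₀).trans (iSup₂_le fun y hy => EReal.coe_le_coe_iff.2 (hy₁ y hy))
    have hge : ((payoff G (feat φ x₁) (feat ψ y₀) : ℝ) : EReal) ≤
        minMaxValue X Y (fun x y => payoff G (feat φ x) (feat ψ y)) :=
      le_iInf₂ fun x hx => (EReal.coe_le_coe_iff.2 (hx₁ hx)).trans
        (le_iSup₂ (f := fun y (_ : y ∈ Y) => (payoff G (feat φ x) (feat ψ y) : EReal)) y₀ hy₀)
    exact ⟨_, (EReal.coe_toReal (ne_top_of_le_ne_top (EReal.coe_ne_top _) hle)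
      (ne_bot_of_le_ne_bot (EReal.coe_ne_bot _) hge)).symm⟩
  -- One η each for the finite response set, the softmax and the polynomial approximation; the last
  -- is the strict slack required by (A3)(ii).
  obtain ⟨η, hη, hηε⟩ : ∃ η : ℝ, 0 < η ∧ 4 * η = ε := ⟨ε / 4, by positivity, by ring⟩
  -- A finite set of responses that nearly attains the value everywhere.
  obtain ⟨t, htY, ht⟩ := exists_finset_forall_exists_lt (Y := Y) (c := v - η) hX
    (h := fun x y => payoff G (feat φ x) (feat ψ y))
    (fun y _ => (contDiff_payoff_left G φ (feat ψ y)).continuous.continuousOn) fun x hx => by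
      have hlt : ((v - η : ℝ) : EReal) < ⨆ y ∈ Y, (payoff G (feat φ x) (feat ψ y) : EReal) :=
        (EReal.coe_lt_coe_iff.2 (sub_lt_self v hη)).trans_le
          (hv.symm.le.trans (iInf₂_le x hx))
      simp only [lt_iSup_iff, EReal.coe_lt_coe_iff] at hlt
      obtain ⟨y, hy, h⟩ := hlt
      exact ⟨y, hy, h⟩
  have : Nonempty t := by
    obtain ⟨x₀, hx₀⟩ := hXne
    obtain ⟨y, hy, -⟩ := ht x₀ hx₀
    exact ⟨⟨y, hy⟩⟩
  set q : t → EuclideanSpace ℝ (Fin d) → ℝ := fun k x => payoff G (feat φ x) (feat ψ k) with hq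
  have hqs : ∀ k, ContDiff ℝ 1 (q k) := fun k => contDiff_payoff_left G φ (feat ψ k)
  obtain ⟨w, hws, hwpos, hwsum, hwq⟩ := exists_smooth_weights q hqs hη
  obtain ⟨μ, hμ, hμw⟩ := exists_pos_le_of_isCompact hX (fun k => (hws k).continuous) hwpos
  obtain ⟨L, hL⟩ := exists_lipschitzOnWith_of_contDiff hX hws
  obtain ⟨C, hC⟩ := hX.bddAbove_image (f := fun x => ∑ k, |q k x|)
    (continuous_finsetSum _ fun k _ => (hqs k).continuous.abs).continuousOn
  have hC' : ∀ x ∈ X, ∑ k, |q k x| ≤ C := fun x hx => hC ⟨x, hx, rfl⟩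
  have hC0 : 0 ≤ C := by
    obtain ⟨x₀, hx₀⟩ := hXne
    exact (Finset.sum_nonneg fun k _ => abs_nonneg _).trans (hC' x₀ hx₀)
  -- Quadratic forms approximating the weights.
  obtain ⟨ρ, hρ, hρμ, hρη⟩ : ∃ ρ : ℝ, 0 < ρ ∧ ρ ≤ μ / 2 ∧ ρ * C ≤ η := by
    refine ⟨min (μ / 2) (η / (C + 1)), by positivity, min_le_left _ _, ?_⟩
    refine (mul_le_mul_of_nonneg_right (min_le_right _ _) hC0).trans ?_
    rw [div_mul_eq_mul_div, div_le_iff₀ (by positivity)]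
    nlinarith
  -- The error 2Lδ becomes ρL/(L + 1) ≤ ρ; the 1 covers L = 0.
  obtain ⟨m₁, φ₁, c₁, hφ₁, happ⟩ := A2 (ρ / (2 * (L + 1))) (by positivity)
  -- Since φ has unit norm, this represents the constant 1.
  set I : Matrix (Fin m ⊕ Fin m₁) (Fin m ⊕ Fin m₁) ℝ := Matrix.fromBlocks 1 0 0 0
  have hI : ∀ x ∈ X, quadForm (feat (Sum.elim φ φ₁) x) I = 1 := fun x hx => by
    rw [feat_sumElim, quadForm_fromBlocks, quadForm_one, hφ x hx]
  obtain ⟨H, hHs, hHsum, hHw⟩ := exists_quadForm_weights hwsum hL happ hI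
  have hHw' : ∀ k, ∀ x ∈ X, |w k x - quadForm (feat (Sum.elim φ φ₁) x) (H k)| ≤ ρ :=
    fun k x hx => (hHw k x hx).trans <| by
      have : 2 * (L * (ρ / (2 * (L + 1)))) = (L : ℝ) * ρ / (L + 1) := by field_simp
      rw [this, div_le_iff₀ (by positivity)]
      linarith
  have hHpos : ∀ k, ∀ x ∈ X, μ / 2 ≤ quadForm (feat (Sum.elim φ φ₁) x) (H k) := fun k x hx => by
    linarith [hμw k x hx, (abs_le.1 (hHw' k x hx)).2]
  have hHq : ∀ x ∈ X, v - 3 * η ≤ ∑ k, q k x * quadForm (feat (Sum.elim φ φ₁) x) (H k) :=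
    fun x hx => by
      obtain ⟨y, hy, hxy⟩ := ht x hx
      have h1 : v - η < q ⟨y, hy⟩ x := hxy
      have h2 := hwq x ⟨y, hy⟩
      have h3 : ∑ k, w k x * q k x - ∑ k, q k x * quadForm (feat (Sum.elim φ φ₁) x) (H k) ≤
          ρ * C := by
        rw [← Finset.sum_sub_distrib]
        refine le_trans (Finset.sum_le_sum fun k _ => ?_)
          ((Finset.mul_sum _ _ _).symm.trans_le (mul_le_mul_of_nonneg_left (hC' x hx) hρ.le))
        rw [mul_comm (w k x), ← mul_sub, mul_comm]
        refine (le_abs_self _).trans ?_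
        rw [abs_mul]
        exact mul_le_mul_of_nonneg_right (hHw' k x hx) (abs_nonneg _)
      linarith
  -- The payoff of the approximate policy, minus the target value, as a quadratic form.
  obtain ⟨F, hFs, hF⟩ := exists_isSymm_quadForm_eq
    (∑ k : t, Matrix.kronecker (Matrix.fromBlocks
        (∑ i, ∑ j, outer (feat ψ k) i j • block G i j) 0 0 0 :
          Matrix (Fin m ⊕ Fin m₁) (Fin m ⊕ Fin m₁) ℝ) (H k) -
      (v - ε) • Matrix.kronecker I I)
  have hFq : ∀ x ∈ X, quadForm (tensorSq (feat (Sum.elim φ φ₁) x)) F =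
      ∑ k, q k x * quadForm (feat (Sum.elim φ φ₁) x) (H k) - (v - ε) := fun x hx => by
    rw [hF, map_sub, map_smul, quadForm_kronecker, hI x hx, map_sum, smul_eq_mul, mul_one, mul_one]
    congr 1
    refine Finset.sum_congr rfl fun k _ => ?_
    rw [quadForm_kronecker, show q k x = _ from payoff_eq_quadForm G _ _, feat_sumElim,
      quadForm_fromBlocks]
  obtain ⟨δ₁, hδ₁, hδH⟩ := exists_pos_mul_frobNorm_le H (half_pos hμ)
  obtain ⟨δ₂, hδ₂, hδF⟩ := exists_pos_mul_frobNorm_le (fun _ : Unit => F) hη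
  have hfrob : ∀ {ι : Type} [Fintype ι] (M : Matrix ι ι ℝ), 0 ≤ frobNorm M :=
    fun M => Real.sqrt_nonneg _
  -- One ratio serves both certificates: δ₁ for the weights `H k`, δ₂ for the payoff form `F`.
  obtain ⟨m₂, φ₂, c₂, hφ₂, hSOS⟩ := A3 m₁ φ₁ c₁ hφ₁ (min δ₁ δ₂) (lt_min hδ₁ hδ₂)
  choose A hA hAH using fun k => hSOS.exists_posSemidef (hHs k) fun x hx =>
    ((mul_le_mul_of_nonneg_right (min_le_left _ _) (hfrob _)).trans (hδH k)).trans (hHpos k x hx)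
  obtain ⟨B, hB, hBF⟩ := hSOS.2 F hFs fun x hx => by
    refine ((mul_le_mul_of_nonneg_right (min_le_right _ _) (hfrob _)).trans (hδF ())).trans ?_
    rw [← quadForm_apply, hFq x hx]
    linarith [hHq x hx]
  -- Both bounds for the normalized enlarged feature map.
  set s : ℝ := 1 + c₁ + c₂ with hs
  have hs0 : 0 < s := by linarith [hφ₁.nonneg hXne, hφ₂.nonneg hXne]
  set Φ := Sum.elim (Sum.elim φ φ₁) φ₂
  have hΦ : HasSqNorm X Φ s := (hφ.sumElim hφ₁).sumElim hφ₂
  have hr : (Real.sqrt s)⁻¹ ^ 2 = s⁻¹ := by rw [inv_pow, Real.sq_sqrt hs0.le]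
  have hunit : ∀ x ∈ X, ∑ i, ((Real.sqrt s)⁻¹ • feat Φ x) i ^ 2 = 1 := fun x hx => by
    simp only [Pi.smul_apply, smul_eq_mul, mul_pow, ← Finset.mul_sum, hΦ x hx, hr]
    exact inv_mul_cancel₀ hs0.ne'
  have hpad : ∀ x y, payoff (s • padBlocks (Fin m₂) (padBlocks (Fin m₁) G))
      ((Real.sqrt s)⁻¹ • feat Φ x) (feat ψ y) = payoff G (feat φ x) (feat ψ y) := fun x y => by
    rw [feat_sumElim, feat_sumElim, payoff_smul_padBlocks _ _ _ _ _ hs0]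
  have hupper : enlargedSOSValue X Y φ ψ G φ₁ c₁ φ₂ c₂ ≤ v := by
    have h := sosValue_le_minMaxValue (G := s • padBlocks (Fin m₂) (padBlocks (Fin m₁) G))
      hunit A1.le (by simpa only [hpad] using hmax)
    simp only [hpad, hv] at h
    exact h
  have hquad : ∀ k, ∀ x ∈ X, quadForm ((Real.sqrt s)⁻¹ • feat Φ x) (s • A k) =
      quadForm (feat (Sum.elim φ φ₁) x) (H k) := fun k x hx => by
    rw [quadForm_smul_left, map_smul, hr, smul_eq_mul, inv_mul_cancel_left₀ hs0.ne', hAH k x hx]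
  have hlower : ((v - ε : ℝ) : EReal) ≤ enlargedSOSValue X Y φ ψ G φ₁ c₁ φ₂ c₂ := by
    -- Normalizing the features divides forms in Φ by s and forms in Φ ⊗ Φ by s², hence the factors
    -- s on `A k` and s² on `B`.
    refine le_sosValue hunit (y := fun k : t => (k : EuclideanSpace ℝ (Fin e)))
      (fun k => htY k.2) (fun k => hψ _ (htY k.2)) (fun k => (hA k).smul hs0.le)
      (fun x hx => ?_) (hB.smul (sq_nonneg s)) fun x hx => ?_
    · simp only [hquad _ x hx, hHsum x hx]
    · simp only [hquad _ x hx]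
      rw [tensorSq_smul, quadForm_smul_left, map_smul, hr, smul_eq_mul, ← mul_assoc, ← mul_pow,
        inv_mul_cancel₀ hs0.ne', one_pow, one_mul]
      refine Eq.trans ?_ ((hFq x hx).symm.trans (hBF x hx))
      simp only [← hs, hpad, hq]
  refine ⟨m₁, φ₁, c₁, m₂, φ₂, c₂, hφ₁, hφ₂, v, _, hv,
    (EReal.coe_toReal (ne_top_of_le_ne_top (EReal.coe_ne_top _) hupper)
      (ne_bot_of_le_ne_bot (EReal.coe_ne_bot _) hlower)).symm, ?_⟩
  have h1 : (enlargedSOSValue X Y φ ψ G φ₁ c₁ φ₂ c₂).toReal ≤ v :=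
    EReal.toReal_le_toReal hupper (ne_bot_of_le_ne_bot (EReal.coe_ne_bot _) hlower)
      (EReal.coe_ne_top _)
  have h2 : v - ε ≤ (enlargedSOSValue X Y φ ψ G φ₁ c₁ φ₂ c₂).toReal :=
    EReal.toReal_le_toReal hlower (EReal.coe_ne_bot _)
      (ne_top_of_le_ne_top (EReal.coe_ne_top _) hupper)
  rw [abs_le]
  constructor <;> linarith
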